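/- Let $q,m\ge 1$ be integers and let $\mathbb U=(U^{(1)},\dots,U^{(m)})$ be an $m$-tuple of linearly independent real skew-symmetric $q\times q$ matrices. Let $\mathbb G=\mathbb G(q,m,\mathbb U)$ be the associated step-two group of corank $m$, that is, $\mathbb R^q\times\mathbb R^m$ with the group law $$(x,t)\cdot(x',t')=\Big(x+x',\ t+t'+\tfrac12\big(\langle U^{(1)}x,x'\rangle,\dots,\langle U^{(m)}x,x'\rangle\big)\Big).$$ For $\theta\in\mathbb R^m$ put $U(\theta)=i\sum_{j=1}^m\theta_jU^{(j)}$, a Hermitian matrix. Let $\Omega_*=\{\tau\in\mathbb R^m:\ \|U(\tau)\|<\pi\}$ (operator norm), and for $g=(x,t)\in\mathbb G$ and $\tau\in\Omega_*$ let $$\phi(g;\tau)=\langle U(\tau)\cot U(\tau)\,x,x\rangle+4\,t\cdot\tau ,$$ where $U\cot U$ is defined by functional calculus with $s\cot s:=1$ at $s=0$. Let $\mathbb M$ be the set of all $g\in\mathbb G$ such that $\phi(g;\cdot)$ has a nondegenerate critical point in $\Omega_*$. The group $\mathbb G$ is called a GM-group if $\overline{\mathbb M}=\mathbb G$ (closure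 in the usual topology of $\mathbb R^q\times\mathbb R^m$). For $\theta\ne0$ let $M(\theta)$ be the multiplicity of the largest eigenvalue of $U(\theta)^2$, and let $\mathbf M=\min_{\theta\neq0}M(\theta)$. **Theorem.** (i) If $\mathbf M\ge m$, then $\mathbb G$ is a GM-group. (ii) Consequently, if $m=1$ or $m=2$, then $\mathbb G$ is a GM-group; that is, every step-two group of corank $1$ or $2$ is a GM-group. -/

import Mathlib

open scoped Matrix

noncomputable section

/-- The data of a step-two group `𝔾(q, m, 𝕌)`: positive integers `q`, `m` and a linearly independent
`m`-tuple `𝕌 = (U⁽¹⁾, …, U⁽ᵐ⁾)` of real skew-symmetric `q × q` matrices. The number `m` is the corank. -/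
structure StepTwoGroup (q m : ℕ) where
  q_pos : 0 < q
  m_pos : 0 < m
  mat : Fin m → Matrix (Fin q) (Fin q) ℝ
  skew : ∀ j, (mat j)ᵀ = -mat j
  linearIndependent : LinearIndependent ℝ mat

namespace StepTwoGroup

variable {q m : ℕ} (G : StepTwoGroup q m)

/-- The underlying set `ℝ^q × ℝ^m` of the group; `g = (x, t)` is `(g.1, g.2)`. -/
def Carrier (_G : StepTwoGroup q m) : Type :=
  EuclideanSpace ℝ (Fin q) × EuclideanSpace ℝ (Fin m)

/-- The usual (Euclidean) topology of `ℝ^q × ℝ^m`. -/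
instance : TopologicalSpace G.Carrier :=
  inferInstanceAs (TopologicalSpace (EuclideanSpace ℝ (Fin q) × EuclideanSpace ℝ (Fin m)))

/-- `⟨𝕌 x, x'⟩ = (⟨U⁽¹⁾ x, x'⟩, …, ⟨U⁽ᵐ⁾ x, x'⟩) ∈ ℝ^m`. -/
def pairing (x x' : EuclideanSpace ℝ (Fin q)) : EuclideanSpace ℝ (Fin m) :=
  WithLp.toLp 2 fun j => (G.mat j *ᵥ x.ofLp) ⬝ᵥ x'.ofLp

lemma pairing_add_left (x y z : EuclideanSpace ℝ (Fin q)) :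
    G.pairing (x + y) z = G.pairing x z + G.pairing y z := by
  ext j; simp [pairing, Matrix.mulVec_add]

lemma pairing_add_right (x y z : EuclideanSpace ℝ (Fin q)) :
    G.pairing x (y + z) = G.pairing x y + G.pairing x z := by
  ext j; simp [pairing]

lemma pairing_neg_left (x y : EuclideanSpace ℝ (Fin q)) :
    G.pairing (-x) y = -G.pairing x y := by
  ext j; simp [pairing, Matrix.mulVec_neg]

lemma pairing_self (x : EuclideanSpace ℝ (Fin q)) : G.pairing x x = 0 := by
  ext j
  have h : (G.mat j *ᵥ x.ofLp) ⬝ᵥ x.ofLp = -((G.mat j *ᵥ x.ofLp) ⬝ᵥ x.ofLp) := by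
    calc (G.mat j *ᵥ x.ofLp) ⬝ᵥ x.ofLp
        = x.ofLp ⬝ᵥ (G.mat j *ᵥ x.ofLp) := dotProduct_comm _ _
      _ = ((G.mat j)ᵀ *ᵥ x.ofLp) ⬝ᵥ x.ofLp := by
          rw [Matrix.dotProduct_mulVec, Matrix.mulVec_transpose]
      _ = -((G.mat j *ᵥ x.ofLp) ⬝ᵥ x.ofLp) := by
          rw [G.skew j, Matrix.neg_mulVec, neg_dotProduct]
  change (G.mat j *ᵥ x.ofLp) ⬝ᵥ x.ofLp = 0
  linarith

/-- The group law `(x, t) · (x', t') = (x + x', t + t' + ½ ⟨𝕌 x, x'⟩)`. -/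
instance : Mul G.Carrier :=
  ⟨fun g h => (g.1 + h.1, g.2 + h.2 + (1 / 2 : ℝ) • G.pairing g.1 h.1)⟩

/-- The identity element `o = (0, 0)`. -/
instance : One G.Carrier := ⟨((0 : EuclideanSpace ℝ (Fin q)), (0 : EuclideanSpace ℝ (Fin m)))⟩

/-- The inverse `(x, t)⁻¹ = (-x, -t)`. -/
instance : Inv G.Carrier := ⟨fun g => (-g.1, -g.2)⟩

lemma mul_def (g h : G.Carrier) :
    g * h = (g.1 + h.1, g.2 + h.2 + (1 / 2 : ℝ) • G.pairing g.1 h.1) := rfl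

lemma one_def :
    (1 : G.Carrier) = ((0 : EuclideanSpace ℝ (Fin q)), (0 : EuclideanSpace ℝ (Fin m))) := rfl

lemma inv_def (g : G.Carrier) : g⁻¹ = (-g.1, -g.2) := rfl

instance : Group G.Carrier :=
  Group.ofLeftAxioms
    (by
      intro a b c
      refine Prod.ext (add_assoc _ _ _) ?_
      change a.2 + b.2 + (1 / 2 : ℝ) • G.pairing a.1 b.1 + c.2
          + (1 / 2 : ℝ) • G.pairing (a.1 + b.1) c.1
        = a.2 + (b.2 + c.2 + (1 / 2 : ℝ) • G.pairing b.1 c.1)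
          + (1 / 2 : ℝ) • G.pairing a.1 (b.1 + c.1)
      simp only [pairing_add_left, pairing_add_right, smul_add]
      abel)
    (by
      intro a
      rw [mul_def, one_def]
      refine Prod.ext (zero_add _) ?_
      have h0 : G.pairing 0 a.1 = 0 := by
        ext j; simp [pairing]
      change (0 : EuclideanSpace ℝ (Fin m)) + a.2 + (1 / 2 : ℝ) • G.pairing 0 a.1 = a.2
      rw [h0, smul_zero, add_zero, zero_add])
    (by
      intro a
      rw [mul_def, one_def, inv_def]
      refine Prod.ext (neg_add_cancel _) ?_
      change -a.2 + a.2 + (1 / 2 : ℝ) • G.pairing (-a.1) a.1 = 0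
      rw [pairing_neg_left, pairing_self, neg_zero, smul_zero, add_zero, neg_add_cancel])

/-- `Ũ(θ) = ∑ⱼ θⱼ U⁽ʲ⁾`, a real skew-symmetric matrix. -/
def Utilde (θ : EuclideanSpace ℝ (Fin m)) : Matrix (Fin q) (Fin q) ℝ :=
  ∑ j, θ j • G.mat j

/-- `U(θ) = i Ũ(θ)`, a Hermitian matrix. -/
def U (θ : EuclideanSpace ℝ (Fin m)) : Matrix (Fin q) (Fin q) ℂ :=
  Complex.I • (G.Utilde θ).map Complex.ofReal

/-- `U(θ)` is Hermitian, so that functional calculus applies to it. -/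
lemma isHermitian_U (θ : EuclideanSpace ℝ (Fin m)) : (G.U θ).IsHermitian := by
  have hs : (G.Utilde θ)ᵀ = -G.Utilde θ := by
    simp [Utilde, Matrix.transpose_sum, G.skew]
  ext i j
  have h : G.Utilde θ j i = -G.Utilde θ i j := congrFun (congrFun hs i) j
  simp [U, h]

/-- The initial reference set `Ω_* = {τ ∈ ℝ^m : ‖U(τ)‖ < π}`, with the operator norm of `U(τ)`
acting on `ℂ^q` with its Hermitian norm. -/
def Omega : Set (EuclideanSpace ℝ (Fin m)) :=
  {τ | ‖Matrix.toEuclideanCLM (𝕜 := ℂ) (G.U τ)‖ < Real.pi}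

/-- The function `s ↦ s cot s`, with its removable singularity at `0` filled in by the value `1`. -/
def sCot (s : ℝ) : ℝ := if s = 0 then 1 else s * Real.cot s

/-- The reference function `φ(g; τ) = ⟨U(τ) cot U(τ) x, x⟩ + 4 t · τ` for `g = (x, t)`, where
`U(τ) cot U(τ)` is given by the functional calculus of the Hermitian matrix `U(τ)`.
(It is only used for `τ ∈ Ω_*`; since `s cot s` is even, the matrix is then real.) -/
def phi (g : G.Carrier) (τ : EuclideanSpace ℝ (Fin m)) : ℝ :=
  ((fun i => (g.1 i : ℂ)) ⬝ᵥ ((G.isHermitian_U τ).cfc sCot *ᵥ fun i => (g.1 i : ℂ))).re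
    + 4 * ∑ j, g.2 j * τ j

end StepTwoGroup

/-- `θ` is a nondegenerate critical point of `f`: `f` is `C²` near `θ`, its differential vanishes at
`θ` and its Hessian at `θ` is a nondegenerate bilinear form. -/
def IsNondegenerateCriticalPoint {m : ℕ} (f : EuclideanSpace ℝ (Fin m) → ℝ)
    (θ : EuclideanSpace ℝ (Fin m)) : Prop :=
  ContDiffAt ℝ 2 f θ ∧ fderiv ℝ f θ = 0 ∧
    ∀ v, (∀ w, fderiv ℝ (fderiv ℝ f) θ v w = 0) → v = 0

namespace StepTwoGroup

variable {q m : ℕ} (G : StepTwoGroup q m)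

/-- The set `𝕄` of all `g` for which `φ(g; ·)` has a nondegenerate critical point in `Ω_*`. -/
def M : Set G.Carrier :=
  {g | ∃ θ ∈ G.Omega, IsNondegenerateCriticalPoint (G.phi g) θ}

/-- `𝔾` is a GM-group if the closure of `𝕄` is `𝔾`. -/
def IsGM : Prop := closure G.M = Set.univ

/-- The maximal eigenvalue of `U(θ)²` (all eigenvalues of this Hermitian matrix are real). -/
def topEigenvalue (θ : EuclideanSpace ℝ (Fin m)) : ℝ :=
  sSup {lam : ℝ | Module.End.HasEigenvalue (Matrix.toLin' (G.U θ ^ 2)) (lam : ℂ)}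

/-- `M(θ)`: the multiplicity of the maximal eigenvalue of `U(θ)²`. -/
def topMultiplicity (θ : EuclideanSpace ℝ (Fin m)) : ℕ :=
  Module.finrank ℂ
    (Module.End.eigenspace (Matrix.toLin' (G.U θ ^ 2)) (G.topEigenvalue θ : ℂ))

/-- `𝐌 = min_{θ ≠ 0} M(θ)`. -/
def minTopMultiplicity : ℕ := sInf {k | ∃ θ, θ ≠ 0 ∧ G.topMultiplicity θ = k}

end StepTwoGroup

end

/-!
Write `λ(θ) = ‖U(θ)‖²`, which is the top eigenvalue of `U(θ)²`. Call `x` generic if for no `θ ≠ 0`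
it is orthogonal to the top eigenspace of `U(θ)²`. The theorem results from three facts.

* If `x` is generic, then for every `t` the function `φ((x, t); ·)` has a maximum in `Ω_*`
  (`exists_isMaxOn_phi`). Since `s cot s ≤ 4 - 1 / (π² - s²)` for `|s| < π`, the form `⟨U(θ) cot
  U(θ) x, x⟩` is at most `4 ‖x‖² - 2 ⟨x, y⟩ + π² ‖y‖² - ‖U(θ) y‖²` for every `y`. At a boundary
  point `‖U(θ)‖ = π`, choosing `y` to be a large multiple of a top eigenvector not orthogonal to
  `x` makes this bound arbitrarily negative; it is continuous in `θ`, so `φ → -∞` at the boundary.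

* For fixed `x` and almost every `t`, all critical points of `φ((x, t); ·)` in `Ω_*` are
  nondegenerate (`dense_nondegenerate`). This is Sard's theorem for the map `θ ↦ -∇⟨U(θ) cot U(θ)
  x, x⟩ / 4`: the critical point equation says that `t` is its value at `θ`, and degeneracy of the
  Hessian says that its derivative at `θ` is singular. Smoothness holds because `z cot z` is
  holomorphic for `|z| < π`, so that `U(θ) cot U(θ)` is locally a power series in `U(θ)`
  (`contDiffAt_quad`).

* If `M(θ) ≥ m` for all `θ ≠ 0`, the generic `x` are dense (`dense_isGeneric`). The non-generic `x`
  are those in the range of `λ(θ) - U(θ)²` for some `θ ≠ 0`. This range does not change when `θ` is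
  scaled, it is spanned by at most `q - m` columns, and the columns are locally Lipschitz in `θ`
  because `λ` is a squared norm. So the non-generic points lie in finitely many locally Lipschitz
  images of spaces of dimension `(m - 1) + (q - m) < q`.

Corank `1` needs only `M(θ) ≥ 1`. For corank `2`, complex conjugation exchanges the eigenspaces of
`U(θ)` for `s` and `-s`, which gives `M(θ) ≥ 2` (`two_le_topMultiplicity`).
-/

noncomputable section

/-! ### Operators that are diagonal in an orthonormal basis -/

section Diagonal

variable {ι E : Type*} [Fintype ι] [NormedAddCommGroup E] [InnerProductSpace ℂ E]
  {T : E →L[ℂ] E} {b : OrthonormalBasis ι ℂ E} {c : ι → ℝ}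

lemma inner_apply_of_diagonal (h : ∀ i, T (b i) = (c i : ℂ) • b i) (x : E) (i : ι) :
    inner ℂ (b i) (T x) = c i * inner ℂ (b i) x := by
  classical
  conv_lhs => rw [← b.sum_repr' x]
  simp [h, b.inner_eq_ite, mul_comm]

lemma re_inner_apply_of_diagonal (h : ∀ i, T (b i) = (c i : ℂ) • b i) (x : E) :
    (inner ℂ x (T x)).re = ∑ i, c i * ‖inner ℂ (b i) x‖ ^ 2 := by
  rw [← b.sum_inner_mul_inner x (T x), Complex.re_sum]
  refine Finset.sum_congr rfl fun i _ => ?_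
  rw [inner_apply_of_diagonal h, mul_left_comm, ← inner_conj_symm x (b i),
    mul_comm ((starRingEnd ℂ) _), Complex.mul_conj, Complex.normSq_eq_norm_sq]
  norm_cast

lemma norm_sq_apply_of_diagonal (h : ∀ i, T (b i) = (c i : ℂ) • b i) (x : E) :
    ‖T x‖ ^ 2 = ∑ i, c i ^ 2 * ‖inner ℂ (b i) x‖ ^ 2 := by
  rw [← b.sum_sq_norm_inner_right (T x)]
  refine Finset.sum_congr rfl fun i _ => ?_
  rw [inner_apply_of_diagonal h, norm_mul, mul_pow]
  simp

lemma abs_le_opNorm_of_diagonal (h : ∀ i, T (b i) = (c i : ℂ) • b i) (i : ι) : |c i| ≤ ‖T‖ := by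
  have := T.le_opNorm (b i)
  simpa [h, norm_smul] using this

lemma exists_abs_eq_opNorm_of_diagonal [Nonempty ι] (h : ∀ i, T (b i) = (c i : ℂ) • b i) :
    ∃ i, |c i| = ‖T‖ := by
  obtain ⟨i, hi⟩ := Finite.exists_max fun i => |c i|
  refine ⟨i, le_antisymm (abs_le_opNorm_of_diagonal h i) ?_⟩
  refine T.opNorm_le_bound (abs_nonneg _) fun x => ?_
  rw [← sq_le_sq₀ (norm_nonneg _) (by positivity), mul_pow, norm_sq_apply_of_diagonal h,
    ← b.sum_sq_norm_inner_right x, Finset.mul_sum]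
  refine Finset.sum_le_sum fun j _ => ?_
  have : c j ^ 2 ≤ |c i| ^ 2 := by
    rw [← sq_abs (c j)]; exact pow_le_pow_left₀ (abs_nonneg _) (hi j) 2
  gcongr

end Diagonal

namespace Matrix.IsHermitian

variable {n : Type*} [Fintype n] [DecidableEq n] {A : Matrix n n ℂ} (hA : A.IsHermitian)

lemma toEuclideanCLM_eigenvectorBasis (i : n) :
    toEuclideanCLM (𝕜 := ℂ) A (hA.eigenvectorBasis i)
      = (hA.eigenvalues i : ℂ) • hA.eigenvectorBasis i := by
  have := hA.mulVec_eigenvectorBasis i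
  ext j
  simpa using congrFun this j

lemma toEuclideanCLM_cfc_eigenvectorBasis (f : ℝ → ℝ) (i : n) :
    toEuclideanCLM (𝕜 := ℂ) (hA.cfc f) (hA.eigenvectorBasis i)
      = (f (hA.eigenvalues i) : ℂ) • hA.eigenvectorBasis i := by
  ext j
  have h : hA.cfc f *ᵥ (hA.eigenvectorBasis i).ofLp
      = (f (hA.eigenvalues i) : ℂ) • (hA.eigenvectorBasis i).ofLp := by
    rw [IsHermitian.cfc, Unitary.conjStarAlgAut_apply, ← mulVec_mulVec, ← mulVec_mulVec]
    have h1 := hA.star_eigenvectorUnitary_mulVec i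
    have h2 := hA.eigenvectorUnitary_mulVec i
    have h3 : (Pi.single i ((RCLike.ofReal ∘ f ∘ hA.eigenvalues) i * 1) : n → ℂ)
        = (f (hA.eigenvalues i) : ℂ) • Pi.single i 1 := by
      rw [← Pi.single_smul]; simp
    rw [h1, diagonal_mulVec_single, h3, mulVec_smul, h2]
  simpa using congrFun h j

end Matrix.IsHermitian

/-! ### The function `s cot s` -/

namespace StepTwoGroup

lemma sCot_neg (s : ℝ) : sCot (-s) = sCot s := by
  simp [sCot, Real.cot_eq_cos_div_sin, div_neg]

/-- Near `±π` the function `s cot s` tends to `-∞` at least as fast as `-1 / (π² - s²)`. -/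
lemma sCot_le {s : ℝ} (hs : |s| < Real.pi) : sCot s ≤ 4 - (Real.pi ^ 2 - s ^ 2)⁻¹ := by
  wlog h0 : 0 ≤ s generalizing s
  · simpa [sCot_neg] using this (s := -s) (by simpa using hs) (by linarith)
  rw [abs_of_nonneg h0] at hs
  have hpi := Real.pi_gt_three
  have hpi4 := Real.pi_le_four
  rcases lt_or_ge s (Real.pi / 2) with h | h
  · have h1 : sCot s ≤ 1 := by
      unfold sCot
      split_ifs with hz
      · exact le_rfl
      have hs0 : 0 < s := lt_of_le_of_ne h0 (Ne.symm hz)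
      have h2 := Real.lt_tan hs0 h
      have h3 : 0 < Real.cos s := Real.cos_pos_of_mem_Ioo ⟨by linarith, h⟩
      have h4 : 0 < Real.sin s := Real.sin_pos_of_pos_of_lt_pi hs0 hs
      rw [Real.tan_eq_sin_div_cos, lt_div_iff₀ h3] at h2
      rw [Real.cot_eq_cos_div_sin, ← mul_div_assoc, div_le_one h4]
      exact h2.le
    have h5 : (Real.pi ^ 2 - s ^ 2)⁻¹ ≤ 1 := inv_le_one_of_one_le₀ (by nlinarith)
    linarith
  · have hs0 : 0 < s := by linarith
    have hu : 0 < Real.pi - s := by linarith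
    have h4 : 0 < Real.sin s := Real.sin_pos_of_pos_of_lt_pi hs0 hs
    -- with `u = π - s`, `-cot s = cot u ≥ (1 - u² / 2) / u`
    have h6 : Real.sin s ≤ Real.pi - s := by
      rw [← Real.sin_pi_sub]; exact Real.sin_le hu.le
    have h7 : 1 - (Real.pi - s) ^ 2 / 2 ≤ -Real.cos s := by
      rw [← Real.cos_pi_sub]; exact Real.one_sub_sq_div_two_le_cos
    have h8 : 0 ≤ -Real.cos s := by
      rw [← Real.cos_pi_sub]; exact Real.cos_nonneg_of_mem_Icc ⟨by linarith, by linarith⟩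
    have h9 : (1 - (Real.pi - s) ^ 2 / 2) / (Real.pi - s) ≤ -Real.cot s := by
      rw [Real.cot_eq_cos_div_sin, ← neg_div]
      calc _ ≤ -Real.cos s / (Real.pi - s) := by gcongr
        _ ≤ _ := by gcongr
    have h10 : (Real.pi ^ 2 - s ^ 2)⁻¹ ≤ s * (Real.pi - s)⁻¹ := by
      rw [inv_le_iff_one_le_mul₀ (by nlinarith)]
      have : s * (Real.pi - s)⁻¹ * (Real.pi ^ 2 - s ^ 2) = s * (Real.pi + s) := by
        field_simp; ring
      rw [this]; nlinarith
    have h11 : s * ((1 - (Real.pi - s) ^ 2 / 2) / (Real.pi - s))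
        = s * (Real.pi - s)⁻¹ - s * (Real.pi - s) / 2 := by
      field_simp
    rw [sCot, if_neg hs0.ne']
    nlinarith [mul_le_mul_of_nonneg_left h9 hs0.le, sq_nonneg (Real.pi / 2 - s)]

/-- The holomorphic function `z cot z` on the disc `|z| < π`, written as `cos z / (sin z / z)` with
the removable singularity of `sin z / z` filled in by `dslope`. -/
def cCot (z : ℂ) : ℂ := Complex.cos z / dslope Complex.sin 0 z

lemma cCot_ofReal (s : ℝ) : cCot s = sCot s := by
  unfold cCot sCot
  split_ifs with h
  · simp [h]
  · rw [dslope_of_ne _ (by exact_mod_cast h)]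
    have : (s : ℂ) ≠ 0 := by exact_mod_cast h
    simp [slope_def_field, Real.cot_eq_cos_div_sin]
    field_simp

lemma differentiableOn_cCot : DifferentiableOn ℂ cCot (Metric.ball 0 Real.pi) := by
  have hb : Metric.ball (0 : ℂ) Real.pi ∈ nhds 0 := Metric.ball_mem_nhds _ Real.pi_pos
  refine Complex.differentiable_cos.differentiableOn.div
    ((Complex.differentiableOn_dslope hb).2 Complex.differentiable_sin.differentiableOn) ?_
  intro z hz h0
  by_cases hz0 : z = 0
  · subst hz0; simp at h0
  · rw [dslope_of_ne _ hz0] at h0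
    simp only [slope_def_field, Complex.sin_zero, sub_zero, div_eq_zero_iff, hz0, or_false,
      Complex.sin_eq_zero_iff] at h0
    obtain ⟨k, rfl⟩ := h0
    have hk : k ≠ 0 := by rintro rfl; simp at hz0
    have : (1 : ℝ) ≤ |(k : ℝ)| := by exact_mod_cast Int.one_le_abs hk
    simp [abs_of_pos Real.pi_pos] at hz
    nlinarith [Real.pi_pos]

open FormalMultilinearSeries in
open scoped ENNReal NNReal in
/-- On a disc of radius less than `π`, `s cot s` is given by a power series, and the same series
defines an analytic function on the ball of that radius of any complex Banach algebra. -/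
lemma exists_sCot_series (A : Type*) [NormedRing A] [NormedAlgebra ℂ A] [CompleteSpace A] {R : ℝ≥0}
    (hR : 0 < R) (hRpi : R < Real.pi) :
    ∃ c : ℕ → ℂ, (∀ s : ℝ, |s| < R → HasSum (fun n => c n * (s : ℂ) ^ n) (sCot s)) ∧
      (∀ a : A, ‖a‖ < R → HasSum (fun n => c n • a ^ n) (ofScalarsSum c a)) ∧
      (∀ a : A, ‖a‖ < R → AnalyticAt ℂ (ofScalarsSum c : A → A) a) := by
  have hd : DifferentiableOn ℂ cCot (Metric.closedBall 0 R) :=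
    differentiableOn_cCot.mono (Metric.closedBall_subset_ball hRpi)
  have hp := hd.hasFPowerSeriesOnBall hR
  set p := cauchyPowerSeries cCot 0 R with hpdef
  have hrad : (R : ℝ≥0∞) ≤ (ofScalars A p.coeff).radius := by
    refine ENNReal.le_of_forall_nnreal_lt fun r hr => ?_
    obtain ⟨C, hC, hb⟩ := p.norm_mul_pow_le_of_lt_radius (hr.trans_le hp.r_le)
    refine FormalMultilinearSeries.le_radius_of_eventually_le _ C ?_
    filter_upwards [Filter.eventually_gt_atTop 0] with n hn
    refine le_trans ?_ (hb n)
    gcongr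
    rw [norm_apply_eq_norm_coef]
    exact ofScalars_norm_le A _ n hn
  have hball : HasFPowerSeriesOnBall (ofScalarsSum p.coeff : A → A) (ofScalars A p.coeff) 0
      (ofScalars A p.coeff).radius :=
    FormalMultilinearSeries.hasFPowerSeriesOnBall _
      (lt_of_lt_of_le (by exact_mod_cast hR) hrad)
  have hmem : ∀ a : A, ‖a‖ < R → a ∈ Metric.eball (0 : A) (ofScalars A p.coeff).radius :=
    fun a ha => Metric.eball_subset_eball hrad
      (by rw [Metric.eball_coe]; simpa using ha)
  refine ⟨p.coeff, fun s hs => ?_, fun a ha => ?_, fun a ha => ?_⟩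
  · have := hp.hasSum (y := (s : ℂ)) (by rw [Metric.eball_coe]; simpa using hs)
    simpa [cCot_ofReal, mul_comm] using this
  · have := hball.hasSum (hmem a ha)
    simpa [ofScalars_apply_eq'] using this
  · exact hball.analyticAt_of_mem (hmem a ha)

/-! ### The reference function as a function of `θ` -/

variable {q m : ℕ} (G : StepTwoGroup q m)

/-- The complexification `ℝ^q → ℂ^q`. -/
def toC (x : EuclideanSpace ℝ (Fin q)) : EuclideanSpace ℂ (Fin q) :=
  WithLp.toLp 2 fun i => (x i : ℂ)

/-- `U(θ)` as an operator on `ℂ^q`, depending linearly on `θ`. -/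
def opU :
    EuclideanSpace ℝ (Fin m) →L[ℝ] (EuclideanSpace ℂ (Fin q) →L[ℂ] EuclideanSpace ℂ (Fin q)) :=
  LinearMap.toContinuousLinearMap
    { toFun := fun θ => Matrix.toEuclideanCLM (𝕜 := ℂ) (G.U θ)
      map_add' := fun θ η => by
        rw [← map_add]; congr 1
        ext i j
        simp [U, Utilde, add_smul, Finset.sum_add_distrib, mul_add]
      map_smul' := fun c θ => by
        ext x i
        have : G.U (c • θ) = (c : ℂ) • G.U θ := by
          ext i j
          simp only [U, Utilde, Matrix.smul_apply, Matrix.map_apply, Matrix.sum_apply,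
            PiLp.smul_apply, smul_eq_mul, Complex.ofReal_sum, Complex.ofReal_mul, Finset.mul_sum]
          exact Finset.sum_congr rfl fun k _ => by ring
        rw [this, map_smul]
        simp }

lemma opU_apply (θ : EuclideanSpace ℝ (Fin m)) :
    G.opU θ = Matrix.toEuclideanCLM (𝕜 := ℂ) (G.U θ) := rfl

lemma mem_Omega {θ : EuclideanSpace ℝ (Fin m)} : θ ∈ G.Omega ↔ ‖G.opU θ‖ < Real.pi := Iff.rfl

lemma isOpen_Omega : IsOpen G.Omega :=
  isOpen_lt (continuous_norm.comp G.opU.continuous) continuous_const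

lemma zero_mem_Omega : (0 : EuclideanSpace ℝ (Fin m)) ∈ G.Omega := by
  rw [mem_Omega, map_zero, norm_zero]; exact Real.pi_pos

lemma opU_injective : Function.Injective G.opU := by
  rw [injective_iff_map_eq_zero]
  intro θ h
  have h1 : G.U θ = 0 := by
    rw [opU_apply] at h
    exact (map_eq_zero_iff _ (Matrix.toEuclideanCLM (n := Fin q) (𝕜 := ℂ)).injective).1 h
  have h2 : G.Utilde θ = 0 := by
    ext i j
    have := congrFun (congrFun h1 i) j
    simpa [U] using this
  ext j
  exact Fintype.linearIndependent_iff.1 G.linearIndependent θ h2 j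

/-- `⟨U(θ) cot U(θ) x, x⟩`, the quadratic part of the reference function. -/
def quad (x : EuclideanSpace ℝ (Fin q)) (θ : EuclideanSpace ℝ (Fin m)) : ℝ :=
  (inner ℂ (toC x) (Matrix.toEuclideanCLM (𝕜 := ℂ) ((G.isHermitian_U θ).cfc sCot) (toC x))).re

lemma phi_eq (g : G.Carrier) (θ : EuclideanSpace ℝ (Fin m)) :
    G.phi g θ = G.quad g.1 θ + 4 * inner ℝ g.2 θ := by
  unfold phi quad
  congr 2
  · rw [EuclideanSpace.inner_eq_star_dotProduct, dotProduct_comm]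
    congr 2
    ext i; simp [toC]
  · simp [PiLp.inner_apply, mul_comm]

/-- Near a point of `Ω_*` the functional calculus `U(θ) cot U(θ)` is a power series in `U(θ)`. -/
lemma contDiffAt_quad (x : EuclideanSpace ℝ (Fin q)) {θ : EuclideanSpace ℝ (Fin m)}
    (hθ : θ ∈ G.Omega) : ContDiffAt ℝ (⊤ : ℕ∞) (G.quad x) θ := by
  obtain ⟨R, hR, hRpi⟩ := exists_between (G.mem_Omega.1 hθ)
  have hR0 : 0 < R := (norm_nonneg _).trans_lt hR
  lift R to NNReal using hR0.le
  obtain ⟨c, hs, ha, han⟩ := exists_sCot_series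
    (EuclideanSpace ℂ (Fin q) →L[ℂ] EuclideanSpace ℂ (Fin q)) (by exact_mod_cast hR0) hRpi
  have hev : ∀ᶠ η in nhds θ, ‖G.opU η‖ < R :=
    (isOpen_lt (continuous_norm.comp G.opU.continuous) continuous_const).mem_nhds hR
  have heq : G.quad x =ᶠ[nhds θ] fun η => (inner ℂ (toC x)
      (FormalMultilinearSeries.ofScalarsSum c (G.opU η) (toC x))).re := by
    filter_upwards [hev] with η hη
    unfold quad
    congr 3
    -- both operators agree on an eigenbasis of `U(η)`
    refine ContinuousLinearMap.coe_inj.1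
      ((G.isHermitian_U η).eigenvectorBasis.toBasis.ext fun i => ?_)
    simp only [OrthonormalBasis.coe_toBasis, ContinuousLinearMap.coe_coe]
    have hdiag := (G.isHermitian_U η).toEuclideanCLM_eigenvectorBasis
    set b := (G.isHermitian_U η).eigenvectorBasis
    set s := (G.isHermitian_U η).eigenvalues
    have hpow : ∀ n : ℕ, ((G.opU η) ^ n) (b i) = ((s i : ℂ) ^ n) • b i := by
      intro n
      induction n with
      | zero => simp
      | succ n ih =>
        rw [pow_succ, mul_apply_eq_comp, opU_apply, hdiag, map_smul, ← opU_apply, ih,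
          smul_smul, pow_succ, mul_comm]
    have h1 := (ha _ hη).mapL (ContinuousLinearMap.apply ℂ _ (b i))
    have h2 := (hs (s i) ((abs_le_opNorm_of_diagonal hdiag i).trans_lt hη)).smul_const (b i)
    rw [Matrix.IsHermitian.toEuclideanCLM_cfc_eigenvectorBasis]
    refine h2.unique ?_
    refine h1.congr_fun fun n => ?_
    simp [hpow, smul_smul]
  refine ContDiffAt.congr_of_eventuallyEq ?_ heq
  have h3 : ContDiffAt ℝ (⊤ : ℕ∞) (fun η => FormalMultilinearSeries.ofScalarsSum c (G.opU η)) θ :=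
    ((han _ hR).contDiffAt.restrict_scalars ℝ).comp θ G.opU.contDiff.contDiffAt
  have h4 : ContDiffAt ℝ (⊤ : ℕ∞)
      (fun η => FormalMultilinearSeries.ofScalarsSum c (G.opU η) (toC x)) θ := by
    have := ((ContinuousLinearMap.apply ℂ (EuclideanSpace ℂ (Fin q)) (toC x)).restrictScalars
      ℝ).contDiff.contDiffAt.comp θ h3
    exact this
  exact Complex.reCLM.contDiff.contDiffAt.comp θ (contDiffAt_const.inner ℂ h4)

/-! ### Existence of interior maxima -/

lemma inner_toC (x y : EuclideanSpace ℝ (Fin q)) :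
    inner ℂ (toC x) (toC y) = ((inner ℝ x y : ℝ) : ℂ) := by
  simp [toC, PiLp.inner_apply]

lemma norm_toC (x : EuclideanSpace ℝ (Fin q)) : ‖toC x‖ = ‖x‖ := by
  simp [toC, EuclideanSpace.norm_eq]

/-- An upper bound for `⟨U(θ) cot U(θ) x, x⟩` on `Ω_*` that is continuous in `θ`. It is the estimate
`s cot s ≤ 4 - 1 / (π² - s²)` combined with `w ‖a‖² + w⁻¹ ‖b‖² ≥ 2 Re ⟨a, b⟩` along the eigenvectors
of `U(θ)`. -/
lemma quad_le (x y : EuclideanSpace ℝ (Fin q)) {θ : EuclideanSpace ℝ (Fin m)} (hθ : θ ∈ G.Omega) :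
    G.quad x θ ≤ 4 * ‖x‖ ^ 2 - 2 * inner ℝ x y + Real.pi ^ 2 * ‖y‖ ^ 2
      - ‖G.opU θ (toC y)‖ ^ 2 := by
  have hdiag := (G.isHermitian_U θ).toEuclideanCLM_eigenvectorBasis
  have hcfc := (G.isHermitian_U θ).toEuclideanCLM_cfc_eigenvectorBasis sCot
  set b := (G.isHermitian_U θ).eigenvectorBasis
  set s := (G.isHermitian_U θ).eigenvalues
  have hxy : inner ℝ x y = ∑ i, (inner ℂ (toC x) (b i) * inner ℂ (b i) (toC y)).re := by
    rw [← Complex.re_sum, b.sum_inner_mul_inner, inner_toC, Complex.ofReal_re]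
  rw [quad, re_inner_apply_of_diagonal hcfc, opU_apply, norm_sq_apply_of_diagonal hdiag, hxy,
    ← norm_toC x, ← norm_toC y, ← b.sum_sq_norm_inner_right (toC x),
    ← b.sum_sq_norm_inner_right (toC y), Finset.mul_sum, Finset.mul_sum, Finset.mul_sum,
    ← Finset.sum_sub_distrib, ← Finset.sum_add_distrib, ← Finset.sum_sub_distrib]
  refine Finset.sum_le_sum fun i _ => ?_
  have hsi : |s i| < Real.pi := (abs_le_opNorm_of_diagonal hdiag i).trans_lt hθ
  have hw : 0 < Real.pi ^ 2 - s i ^ 2 := by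
    have := (sq_lt_sq₀ (abs_nonneg _) Real.pi_pos.le).2 hsi
    rw [sq_abs] at this; linarith
  have hre : (inner ℂ (toC x) (b i) * inner ℂ (b i) (toC y)).re
      ≤ ‖inner ℂ (b i) (toC x)‖ * ‖inner ℂ (b i) (toC y)‖ := by
    refine (Complex.re_le_norm _).trans ?_
    rw [norm_mul, norm_inner_symm]
  have h1 := mul_le_mul_of_nonneg_right (sCot_le hsi) (sq_nonneg ‖inner ℂ (b i) (toC x)‖)
  set w := Real.pi ^ 2 - s i ^ 2
  set α := ‖inner ℂ (b i) (toC x)‖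
  set β := ‖inner ℂ (b i) (toC y)‖
  have h2 : 2 * (α * β) ≤ w⁻¹ * α ^ 2 + w * β ^ 2 := by
    have : 0 ≤ w⁻¹ * (α - w * β) ^ 2 := by positivity
    have h3 : w⁻¹ * (α - w * β) ^ 2 = w⁻¹ * α ^ 2 + w * β ^ 2 - 2 * (α * β) := by
      field_simp; ring
    linarith
  have h4 : Real.pi ^ 2 * β ^ 2 - s i ^ 2 * β ^ 2 = w * β ^ 2 := by ring
  linarith

/-- `x` is generic if for no `θ ≠ 0` it is orthogonal to all vectors at which the operator norm of
`U(θ)` is attained, that is, to the top eigenspace of `U(θ)²`. -/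
def IsGeneric (x : EuclideanSpace ℝ (Fin q)) : Prop :=
  ∀ θ : EuclideanSpace ℝ (Fin m), θ ≠ 0 →
    ∃ e : EuclideanSpace ℝ (Fin q), ‖G.opU θ (toC e)‖ = ‖G.opU θ‖ * ‖e‖ ∧ inner ℝ x e ≠ 0

lemma continuousOn_phi (g : G.Carrier) : ContinuousOn (G.phi g) G.Omega := by
  have : G.phi g = fun θ => G.quad g.1 θ + 4 * inner ℝ g.2 θ := funext (G.phi_eq g)
  rw [this]
  refine ContinuousOn.add
    (fun θ hθ => (G.contDiffAt_quad g.1 hθ).continuousAt.continuousWithinAt) ?_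
  fun_prop

lemma toC_smul (c : ℝ) (x : EuclideanSpace ℝ (Fin q)) : toC (c • x) = (c : ℂ) • toC x := by
  ext i; simp [toC]

/-- For generic `x` the reference function tends to `-∞` at the boundary of `Ω_*`, hence it attains
its maximum over `Ω_*`. -/
lemma exists_isMaxOn_phi (g : G.Carrier) (hg : G.IsGeneric g.1) :
    ∃ θ ∈ G.Omega, IsMaxOn (G.phi g) G.Omega θ := by
  -- `B y` is the continuous majorant of `φ(g; ·)` provided by `quad_le`
  let B : EuclideanSpace ℝ (Fin q) → EuclideanSpace ℝ (Fin m) → ℝ := fun y θ =>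
    4 * ‖g.1‖ ^ 2 - 2 * inner ℝ g.1 y + Real.pi ^ 2 * ‖y‖ ^ 2 - ‖G.opU θ (toC y)‖ ^ 2
      + 4 * inner ℝ g.2 θ
  have hB : ∀ y, ∀ θ ∈ G.Omega, G.phi g θ ≤ B y θ := fun y θ hθ => by
    rw [phi_eq]; exact add_le_add_left (G.quad_le g.1 y hθ) _
  let K : Set (EuclideanSpace ℝ (Fin m)) := {θ | ‖G.opU θ‖ ≤ Real.pi} ∩ ⋂ y, {θ | G.phi g 0 ≤ B y θ}
  have hKc : IsCompact K := by
    have hanti : Topology.IsClosedEmbedding G.opU :=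
      LinearMap.isClosedEmbedding_of_injective (f := G.opU.toLinearMap)
        (LinearMap.ker_eq_bot.2 G.opU_injective)
    have h1 : IsCompact {θ | ‖G.opU θ‖ ≤ Real.pi} := by
      have := hanti.isCompact_preimage (isCompact_closedBall 0 Real.pi)
      simpa [Set.preimage, mem_closedBall_zero_iff] using this
    refine h1.inter_right (isClosed_iInter fun y => isClosed_le continuous_const ?_)
    have h2 : Continuous fun θ => G.opU θ (toC y) :=
      (ContinuousLinearMap.apply ℂ (EuclideanSpace ℂ (Fin q)) (toC y)).continuous.comp
        G.opU.continuous
    fun_prop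
  have hKsub : K ⊆ G.Omega := by
    rintro θ ⟨h1, h2⟩
    rw [mem_Omega]
    refine lt_of_le_of_ne (Set.mem_ofPred.1 h1) fun heq => ?_
    have hθ0 : θ ≠ 0 := by
      rintro rfl; rw [map_zero, norm_zero] at heq; exact Real.pi_pos.ne heq
    obtain ⟨e, he, hne⟩ := hg θ hθ0
    -- along `y = c e` the majorant at the boundary point `θ` is affine in `c`, so unbounded below
    have h3 : ∀ c : ℝ, G.phi g 0 ≤ 4 * ‖g.1‖ ^ 2 - 2 * c * inner ℝ g.1 e + 4 * inner ℝ g.2 θ := by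
      intro c
      have h4 : G.phi g 0 ≤ B (c • e) θ := Set.mem_iInter.1 h2 (c • e)
      refine h4.trans (le_of_eq ?_)
      simp only [B, toC_smul, map_smul, norm_smul, he, heq, inner_smul_right, mul_pow,
        Complex.norm_real]
      ring
    have := h3 ((4 * ‖g.1‖ ^ 2 + 4 * inner ℝ g.2 θ - G.phi g 0 + 1) / (2 * inner ℝ g.1 e))
    have h5 : 2 * ((4 * ‖g.1‖ ^ 2 + 4 * inner ℝ g.2 θ - G.phi g 0 + 1) / (2 * inner ℝ g.1 e))
        * inner ℝ g.1 e = 4 * ‖g.1‖ ^ 2 + 4 * inner ℝ g.2 θ - G.phi g 0 + 1 := by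
      field_simp
    linarith
  have hmem : ∀ θ ∈ G.Omega, G.phi g 0 ≤ G.phi g θ → θ ∈ K := fun θ hθ h =>
    ⟨le_of_lt (G.mem_Omega.1 hθ), Set.mem_iInter.2 fun y => h.trans (hB y θ hθ)⟩
  have h0K := hmem 0 G.zero_mem_Omega le_rfl
  obtain ⟨θ, hθ, hmax⟩ := hKc.exists_isMaxOn ⟨0, h0K⟩ ((G.continuousOn_phi g).mono hKsub)
  refine ⟨θ, hKsub hθ, fun η hη => ?_⟩
  rcases le_total (G.phi g 0) (G.phi g η) with h | h
  · exact hmax (hmem η hη h)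
  · exact h.trans (hmax h0K)

/-! ### Nondegeneracy for almost every `t` -/

/-- Sard's theorem for gradient maps, phrased through linear perturbations: for all `t` outside a
null set, every critical point of `f + 4 ⟨t, ·⟩` in `Ω` is nondegenerate. The critical point
equation is `t = -∇f / 4`, and a critical point is degenerate exactly if the derivative of the map
`-∇f / 4` is singular there. -/
lemma dense_nondegenerate {m : ℕ} {f : EuclideanSpace ℝ (Fin m) → ℝ}
    {Ω : Set (EuclideanSpace ℝ (Fin m))} (hf : ∀ θ ∈ Ω, ContDiffAt ℝ 2 f θ) :
    Dense {t : EuclideanSpace ℝ (Fin m) | ∀ θ ∈ Ω,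
      fderiv ℝ (fun η => f η + 4 * inner ℝ t η) θ = 0 →
        IsNondegenerateCriticalPoint (fun η => f η + 4 * inner ℝ t η) θ} := by
  let V := EuclideanSpace ℝ (Fin m)
  let b : OrthonormalBasis (Fin m) ℝ V := EuclideanSpace.basisFun (Fin m) ℝ
  -- `ι` identifies a linear form with the vector representing it
  let ι : (V →L[ℝ] ℝ) →L[ℝ] V :=
    ∑ j, (ContinuousLinearMap.apply ℝ ℝ (b j)).smulRight (b j)
  let D : V → V := fun θ => ι (fderiv ℝ f θ)
  have hfd : ∀ θ ∈ Ω, DifferentiableAt ℝ (fderiv ℝ f) θ := fun θ hθ =>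
    ((hf θ hθ).fderiv_right (m := 1) (by norm_num)).differentiableAt (by norm_num)
  let Φ : V → V := fun θ => (-(1 / 4 : ℝ)) • D θ
  let Φ' : V → V →L[ℝ] V := fun θ =>
    (-(1 / 4 : ℝ)) • ι.comp (fderiv ℝ (fderiv ℝ f) θ)
  have hΦ : ∀ θ ∈ Ω, HasFDerivAt Φ (Φ' θ) θ := fun θ hθ =>
    (ι.hasFDerivAt.comp θ (hfd θ hθ).hasFDerivAt).const_smul (-(1 / 4 : ℝ))
  let S : Set V := {θ | θ ∈ Ω ∧ (Φ' θ).det = 0}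
  have hS : MeasureTheory.volume (Φ '' S) = 0 :=
    MeasureTheory.addHaar_image_eq_zero_of_det_fderivWithin_eq_zero _
      (fun θ hθ => (hΦ θ hθ.1).hasFDerivWithinAt) fun θ hθ => hθ.2
  have hdense : Dense (Φ '' S)ᶜ := by
    rw [← interior_eq_empty_iff_dense_compl]
    exact MeasureTheory.Measure.interior_eq_empty_of_null hS
  refine hdense.mono fun t ht θ hθ hcrit => ?_
  have hlin : ∀ η : V, HasFDerivAt (fun η : V => 4 * inner ℝ t η) ((4 : ℝ) • innerSL ℝ t) η :=
    fun η => ((innerSL ℝ t).hasFDerivAt (x := η)).const_mul 4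
  have hsum : ∀ η, DifferentiableAt ℝ f η → fderiv ℝ (fun η => f η + 4 * inner ℝ t η) η
      = fderiv ℝ f η + (4 : ℝ) • innerSL ℝ t := fun η hη =>
    (hη.hasFDerivAt.add (hlin η)).fderiv
  have hfdiff := (hf θ hθ).differentiableAt (by norm_num)
  have hcd : ContDiffAt ℝ 2 (fun η => f η + 4 * inner ℝ t η) θ := by
    refine (hf θ hθ).add (contDiffAt_const.mul (contDiffAt_const.inner ℝ contDiffAt_id))
  refine ⟨hcd, hcrit, fun v hv => ?_⟩
  have hev : fderiv ℝ (fun η => f η + 4 * inner ℝ t η) =ᶠ[nhds θ]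
      fun η => fderiv ℝ f η + (4 : ℝ) • innerSL ℝ t := by
    filter_upwards [(hf θ hθ).eventually (by norm_num)] with η hη
    exact hsum η (hη.differentiableAt (by norm_num))
  have hhess : fderiv ℝ (fderiv ℝ (fun η => f η + 4 * inner ℝ t η)) θ
      = fderiv ℝ (fderiv ℝ f) θ := by
    rw [hev.fderiv_eq, fderiv_add_const]
  rw [hhess] at hv
  have ht2 : Φ θ = t := by
    rw [hsum θ hfdiff] at hcrit
    have hft : fderiv ℝ f θ = (-4 : ℝ) • innerSL ℝ t := by
      rw [neg_smul]; exact eq_neg_of_add_eq_zero_left hcrit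
    conv_rhs => rw [← b.sum_repr' t]
    simp only [Φ, D, ι, hft, sum_apply, Finset.smul_sum]
    refine Finset.sum_congr rfl fun j _ => ?_
    simp only [ContinuousLinearMap.smulRight_apply, ContinuousLinearMap.apply_apply,
      smul_apply, innerSL_apply_apply, smul_smul, smul_eq_mul,
      real_inner_comm t (b j)]
    congr 1
    ring
  have hdet : (Φ' θ).det ≠ 0 := fun h0 => ht ⟨θ, ⟨hθ, h0⟩, ht2⟩
  have hzero : fderiv ℝ (fderiv ℝ f) θ v = 0 := by ext w; exact hv w
  have hker : Φ' θ v = 0 := by simp [Φ', hzero]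
  by_contra hv0
  refine hdet (LinearMap.det_eq_zero_iff_ker_ne_bot.2 fun hbot => hv0 ?_)
  exact (Submodule.mem_bot ℝ).1 (hbot ▸ LinearMap.mem_ker.2 hker)

lemma isGM_of_dense_isGeneric (h : Dense {x | G.IsGeneric x}) : G.IsGM := by
  refine Set.eq_univ_of_forall fun g => ?_
  rw [mem_closure_iff_nhds]
  intro N hN
  obtain ⟨A, hA, B, hB, hAB⟩ := mem_nhds_prod_iff.1 hN
  obtain ⟨x, hx, hxA⟩ := h.inter_nhds_nonempty hA
  have hd := dense_nondegenerate (f := G.quad x) (Ω := G.Omega) fun θ hθ =>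
    (G.contDiffAt_quad x hθ).of_le (by norm_cast)
  obtain ⟨t, ht, htB⟩ := hd.inter_nhds_nonempty hB
  refine ⟨(x, t), hAB ⟨hxA, htB⟩, ?_⟩
  obtain ⟨θ, hθ, hmax⟩ := G.exists_isMaxOn_phi (x, t) hx
  have hphi : G.phi (x, t) = fun η => G.quad x η + 4 * inner ℝ t η := funext (G.phi_eq (x, t))
  refine ⟨θ, hθ, ?_⟩
  rw [hphi] at hmax ⊢
  exact ht θ hθ (hmax.isLocalMax (G.isOpen_Omega.mem_nhds hθ)).fderiv_eq_zero

/-! ### The top eigenspace of `U(θ)²` -/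

/-- The real symmetric matrix of the operator `‖U(θ)‖² - U(θ)²`. Its kernel is the real top
eigenspace of `U(θ)²`, and its range is the orthogonal complement of that eigenspace. -/
def defect (θ : EuclideanSpace ℝ (Fin m)) : Matrix (Fin q) (Fin q) ℝ :=
  ‖G.opU θ‖ ^ 2 • 1 + G.Utilde θ ^ 2

lemma defect_map (θ : EuclideanSpace ℝ (Fin m)) :
    (G.defect θ).map Complex.ofReal = ((‖G.opU θ‖ ^ 2 : ℝ) : ℂ) • 1 - G.U θ ^ 2 := by
  have h : G.U θ ^ 2 = -((G.Utilde θ ^ 2).map Complex.ofReal) := by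
    have : (G.Utilde θ ^ 2).map Complex.ofReal = ((G.Utilde θ).map Complex.ofReal) ^ 2 :=
      map_pow (RingHom.mapMatrix Complex.ofRealHom) _ 2
    rw [this, U, smul_pow, Complex.I_sq, neg_one_smul]
  rw [h, sub_neg_eq_add]
  ext i j
  by_cases hij : i = j <;> simp [defect, hij]

lemma opU_opU_apply (θ : EuclideanSpace ℝ (Fin m)) (v : EuclideanSpace ℂ (Fin q)) :
    (G.opU θ (G.opU θ v)).ofLp = G.U θ ^ 2 *ᵥ v.ofLp := by
  simp [opU_apply, pow_two]

lemma hasEigenvalue_iff (θ : EuclideanSpace ℝ (Fin m)) (μ : ℂ) :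
    Module.End.HasEigenvalue (Matrix.toLin' (G.U θ ^ 2)) μ ↔
      ∃ v : EuclideanSpace ℂ (Fin q), v ≠ 0 ∧ G.opU θ (G.opU θ v) = μ • v := by
  constructor
  · intro h
    obtain ⟨v, hv, hv0⟩ := h.exists_hasEigenvector
    refine ⟨WithLp.toLp 2 v, by simpa using hv0, ?_⟩
    apply (WithLp.ofLp_injective 2)
    rw [opU_opU_apply]
    have := Module.End.mem_eigenspace_iff.1 hv
    rwa [Matrix.toLin'_apply] at this
  · rintro ⟨v, hv0, hv⟩
    refine Module.End.hasEigenvalue_of_hasEigenvector (x := v.ofLp) ⟨?_, by simpa using hv0⟩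
    rw [Module.End.mem_eigenspace_iff, Matrix.toLin'_apply, ← opU_opU_apply, hv]
    rfl

/-- An eigenvector of `U(θ)` whose eigenvalue has maximal modulus. -/
lemma exists_eigenvector_norm (θ : EuclideanSpace ℝ (Fin m)) :
    ∃ (v : EuclideanSpace ℂ (Fin q)) (s : ℝ), v ≠ 0 ∧ |s| = ‖G.opU θ‖ ∧
      G.opU θ v = (s : ℂ) • v := by
  have : Nonempty (Fin q) := ⟨⟨0, G.q_pos⟩⟩
  have hdiag := (G.isHermitian_U θ).toEuclideanCLM_eigenvectorBasis
  obtain ⟨i, hi⟩ := exists_abs_eq_opNorm_of_diagonal hdiag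
  exact ⟨_, _, (G.isHermitian_U θ).eigenvectorBasis.orthonormal.ne_zero i, hi, hdiag i⟩

lemma topEigenvalue_eq (θ : EuclideanSpace ℝ (Fin m)) : G.topEigenvalue θ = ‖G.opU θ‖ ^ 2 := by
  refine IsGreatest.csSup_eq ⟨?_, ?_⟩
  · obtain ⟨v, s, hv0, hs, hv⟩ := G.exists_eigenvector_norm θ
    refine (G.hasEigenvalue_iff θ _).2 ⟨v, hv0, ?_⟩
    rw [hv, map_smul, hv, smul_smul, ← hs, sq_abs]
    push_cast
    rw [pow_two]
  · intro μ hμ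
    obtain ⟨v, hv0, hv⟩ := (G.hasEigenvalue_iff θ _).1 hμ
    have h1 : ‖G.opU θ (G.opU θ v)‖ ≤ ‖G.opU θ‖ ^ 2 * ‖v‖ :=
      ((G.opU θ).le_opNorm _).trans (by
        rw [pow_two, mul_assoc]; gcongr; exact (G.opU θ).le_opNorm _)
    rw [hv, norm_smul, Complex.norm_real] at h1
    exact (le_abs_self μ).trans (le_of_mul_le_mul_right h1 (norm_pos_iff.2 hv0))

/-- Vectors of the real top eigenspace realize the operator norm of `U(θ)`. -/
lemma norm_opU_of_defect_eq_zero {θ : EuclideanSpace ℝ (Fin m)} {e : EuclideanSpace ℝ (Fin q)}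
    (he : G.defect θ *ᵥ e.ofLp = 0) : ‖G.opU θ (toC e)‖ = ‖G.opU θ‖ * ‖e‖ := by
  have h1 : G.opU θ (G.opU θ (toC e)) = ((‖G.opU θ‖ ^ 2 : ℝ) : ℂ) • toC e := by
    apply (WithLp.ofLp_injective 2)
    rw [opU_opU_apply]
    have h2 : (G.defect θ).map Complex.ofReal *ᵥ (toC e).ofLp = 0 := by
      have : (toC e).ofLp = Complex.ofRealHom ∘ e.ofLp := rfl
      ext i
      rw [this]
      have := RingHom.map_mulVec Complex.ofRealHom (G.defect θ) e.ofLp i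
      rw [he] at this
      exact this.symm.trans (by simp)
    rw [defect_map, Matrix.sub_mulVec, sub_eq_zero, Matrix.smul_mulVec, Matrix.one_mulVec] at h2
    exact h2.symm
  have hsymm : inner ℂ (G.opU θ (toC e)) (G.opU θ (toC e))
      = inner ℂ (toC e) (G.opU θ (G.opU θ (toC e))) := by
    have hadj : ContinuousLinearMap.adjoint (G.opU θ) = G.opU θ := by
      rw [← ContinuousLinearMap.star_eq_adjoint, opU_apply, ← map_star,
        Matrix.star_eq_conjTranspose, G.isHermitian_U θ]
    conv_rhs => rw [← ContinuousLinearMap.adjoint_inner_left, hadj]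
  rw [h1, inner_smul_right, inner_self_eq_norm_sq_to_K, inner_self_eq_norm_sq_to_K,
    norm_toC] at hsymm
  have h3 : ‖G.opU θ (toC e)‖ ^ 2 = (‖G.opU θ‖ * ‖e‖) ^ 2 := by
    rw [mul_pow]
    exact Complex.ofReal_injective (by push_cast at hsymm ⊢; exact hsymm)
  exact (sq_eq_sq₀ (norm_nonneg _) (by positivity)).1 h3

lemma defect_transpose (θ : EuclideanSpace ℝ (Fin m)) : (G.defect θ)ᵀ = G.defect θ := by
  have hs : (G.Utilde θ)ᵀ = -G.Utilde θ := by
    simp [Utilde, Matrix.transpose_sum, G.skew]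
  simp [defect, Matrix.transpose_pow, hs]

lemma isGeneric_of_notMem_range {x : EuclideanSpace ℝ (Fin q)}
    (hx : ∀ θ : EuclideanSpace ℝ (Fin m), θ ≠ 0 → ∀ z, G.defect θ *ᵥ z ≠ x.ofLp) :
    G.IsGeneric x := by
  intro θ hθ
  by_contra! hcon
  let T := Matrix.toEuclideanLin (G.defect θ)
  have hT : T.adjoint = T := by
    rw [← Matrix.toEuclideanLin_conjTranspose_eq_adjoint,
      Matrix.conjTranspose_eq_transpose_of_trivial, defect_transpose]
  have hmem : x ∈ (LinearMap.ker T)ᗮ := by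
    rw [Submodule.mem_orthogonal']
    intro e he
    refine hcon e (G.norm_opU_of_defect_eq_zero ?_)
    have : T e = 0 := he
    simpa [T, Matrix.toLpLin_apply] using this
  rw [LinearMap.orthogonal_ker, hT] at hmem
  obtain ⟨z, hz⟩ := hmem
  refine hx θ hθ z.ofLp ?_
  rw [← hz]
  simp [T, Matrix.toLpLin_apply]

lemma linearIndependent_ofReal_comp {ι n : Type*} [Fintype ι] {v : ι → n → ℝ}
    (hv : LinearIndependent ℝ v) : LinearIndependent ℂ fun i k => (v i k : ℂ) := by
  rw [Fintype.linearIndependent_iff] at hv ⊢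
  intro c hc
  have hre := hv (fun i => (c i).re) (by
    ext k
    have := congrArg Complex.re (congrFun hc k)
    simpa [Finset.sum_apply] using this)
  have him := hv (fun i => (c i).im) (by
    ext k
    have := congrArg Complex.im (congrFun hc k)
    simpa [Finset.sum_apply] using this)
  exact fun i => Complex.ext (hre i) (him i)

/-- The range of `defect θ` is spanned by at most `q - M(θ)` of its columns. -/
lemma exists_columns_span (θ : EuclideanSpace ℝ (Fin m)) :
    ∃ r, r + G.topMultiplicity θ ≤ q ∧ ∃ f : Fin r → Fin q, ∀ z : Fin q → ℝ, ∃ y : Fin r → ℝ,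
      G.defect θ *ᵥ z = ∑ i, y i • (G.defect θ).col (f i) := by
  obtain ⟨g, hg, hspan, hind⟩ :=
    Submodule.exists_fun_fin_finrank_span_eq ℝ (Set.range (G.defect θ).col)
  choose f hf using hg
  refine ⟨_, ?_, f, fun z => ?_⟩
  · have hind' := linearIndependent_ofReal_comp hind
    have hrange : ∀ i, (fun k => (g i k : ℂ))
        ∈ LinearMap.range (Matrix.toLin' ((G.defect θ).map Complex.ofReal)) := fun i =>
      ⟨Pi.single (f i) 1, by ext k; simp [← hf i]⟩
    have h1 := (LinearIndependent.of_comp (Submodule.subtype _)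
      (v := fun i => (⟨_, hrange i⟩ : LinearMap.range (Matrix.toLin'
        ((G.defect θ).map Complex.ofReal)))) hind').fintype_card_le_finrank
    have h2 := LinearMap.finrank_range_add_finrank_ker
      (Matrix.toLin' ((G.defect θ).map Complex.ofReal))
    have h3 : LinearMap.ker (Matrix.toLin' ((G.defect θ).map Complex.ofReal))
        = Module.End.eigenspace (Matrix.toLin' (G.U θ ^ 2)) (G.topEigenvalue θ : ℂ) := by
      ext v
      rw [Module.End.mem_eigenspace_iff, LinearMap.mem_ker, defect_map, topEigenvalue_eq,
        Matrix.toLin'_apply, Matrix.toLin'_apply, Matrix.sub_mulVec, sub_eq_zero,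
        Matrix.smul_mulVec, Matrix.one_mulVec, eq_comm]
    rw [h3] at h2
    simp only [Fintype.card_fin, Module.finrank_fin_fun] at h1 h2
    rw [topMultiplicity]
    omega
  · have hz : G.defect θ *ᵥ z ∈ Submodule.span ℝ (Set.range g) := by
      rw [hspan, ← Matrix.range_mulVecLin]
      exact ⟨z, rfl⟩
    obtain ⟨y, hy⟩ := (Submodule.mem_span_range_iff_exists_fun ℝ).1 hz
    exact ⟨y, by simp only [hf, hy]⟩

/-! ### Generic points are dense -/

lemma defect_smul (c : ℝ) (θ : EuclideanSpace ℝ (Fin m)) :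
    G.defect (c • θ) = c ^ 2 • G.defect θ := by
  have h : G.Utilde (c • θ) = c • G.Utilde θ := by
    simp [Utilde, Finset.smul_sum, smul_smul]
  rw [defect, defect, h, map_smul, norm_smul, mul_pow, Real.norm_eq_abs, sq_abs, smul_pow, smul_add,
    smul_smul]

/-- The affine parametrization of the hyperplane `θ_j = 1`. -/
def chart {k : ℕ} (j : Fin (k + 1)) (η : EuclideanSpace ℝ (Fin k)) :
    EuclideanSpace ℝ (Fin (k + 1)) :=
  EuclideanSpace.single j 1 + ∑ l, η l • EuclideanSpace.single (j.succAbove l) 1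

lemma exists_chart_eq {k : ℕ} {j : Fin (k + 1)} {θ : EuclideanSpace ℝ (Fin (k + 1))}
    (hθ : θ j = 1) :
    ∃ η, chart j η = θ := by
  refine ⟨WithLp.toLp 2 fun l => θ (j.succAbove l), ?_⟩
  have h := (EuclideanSpace.basisFun (Fin (k + 1)) ℝ).sum_repr θ
  rw [Fin.sum_univ_succAbove _ j] at h
  simpa [chart, hθ] using h

lemma contDiff_chart {k : ℕ} (j : Fin (k + 1)) : ContDiff ℝ 1 (chart j) := by
  unfold chart
  fun_prop

/-- Linear combinations of the columns `f i` of `defect θ`, with `θ` in the hyperplane `θ_j = 1`. -/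
def columnMap {k r : ℕ} (G : StepTwoGroup q (k + 1)) (j : Fin (k + 1)) (f : Fin r → Fin q)
    (p : EuclideanSpace ℝ (Fin k) × (Fin r → ℝ)) : EuclideanSpace ℝ (Fin q) :=
  WithLp.toLp 2 (∑ i, p.2 i • (G.defect (chart j p.1)).col (f i))

/-- `columnMap` with the operator norm of `U(θ)` replaced by an independent variable is smooth. -/
lemma contDiff_columns {k r : ℕ} (G : StepTwoGroup q (k + 1)) (j : Fin (k + 1))
    (f : Fin r → Fin q) :
    ContDiff ℝ 1 fun p : (EuclideanSpace ℝ (Fin k) × (Fin r → ℝ)) × ℝ =>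
      (WithLp.toLp 2 (∑ i, p.1.2 i • (p.2 ^ 2 • (1 : Matrix (Fin q) (Fin q) ℝ)
        + G.Utilde (chart j p.1.1) ^ 2).col (f i)) : EuclideanSpace ℝ (Fin q)) := by
  rw [contDiff_euclidean]
  intro a
  have hcoord : ∀ l, ContDiff ℝ 1
      fun p : (EuclideanSpace ℝ (Fin k) × (Fin r → ℝ)) × ℝ => chart j p.1.1 l :=
    contDiff_euclidean.1 ((contDiff_chart j).comp (contDiff_fst.comp contDiff_fst))
  have hU : ∀ (θ : EuclideanSpace ℝ (Fin (k + 1))) (b : Fin q), (G.Utilde θ ^ 2) a b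
      = ∑ l, (∑ j, θ j * G.mat j a l) * ∑ j, θ j * G.mat j l b := fun θ b => by
    simp [pow_two, Matrix.mul_apply, Utilde, Matrix.sum_apply]
  simp only [Finset.sum_apply, Pi.smul_apply, Matrix.col_apply, Matrix.add_apply,
    Matrix.smul_apply, smul_eq_mul, hU]
  exact ContDiff.sum fun i _ => ContDiff.mul (by fun_prop) <| ContDiff.add (by fun_prop) <|
    ContDiff.sum fun l _ => (ContDiff.sum fun b _ => (hcoord b).mul contDiff_const).mul
      (ContDiff.sum fun b _ => (hcoord b).mul contDiff_const)

/-- The only part of `columnMap` that is not smooth is the operator norm of `U(θ)`, which is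
Lipschitz in `θ`. -/
lemma locallyLipschitz_columnMap {k r : ℕ} (G : StepTwoGroup q (k + 1)) (j : Fin (k + 1))
    (f : Fin r → Fin q) : LocallyLipschitz (G.columnMap j f) := by
  have hN : LocallyLipschitz
      fun p : EuclideanSpace ℝ (Fin k) × (Fin r → ℝ) => ‖G.opU (chart j p.1)‖ :=
    lipschitzWith_one_norm.locallyLipschitz.comp
      (G.opU.contDiff.comp ((contDiff_chart j).comp contDiff_fst)).locallyLipschitz
  have hpair : LocallyLipschitz
      fun p : EuclideanSpace ℝ (Fin k) × (Fin r → ℝ) => (p, ‖G.opU (chart j p.1)‖) :=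
    LocallyLipschitz.id.prodMk hN
  have hcomp := (G.contDiff_columns j f).locallyLipschitz.comp hpair
  exact hcomp

/-- The non-generic points form a set of Hausdorff dimension at most `(m - 1) + (q - 𝐌) < q`: up to
scaling, `θ` varies in finitely many affine hyperplanes of dimension `m - 1`, and the range of
`defect θ` has dimension at most `q - 𝐌`. -/
lemma dense_isGeneric (h : ∀ θ : EuclideanSpace ℝ (Fin m), θ ≠ 0 → m ≤ G.topMultiplicity θ) :
    Dense {x | G.IsGeneric x} := by
  obtain ⟨k, rfl⟩ := Nat.exists_eq_succ_of_ne_zero G.m_pos.ne'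
  let I := Σ (_ : Fin (k + 1)) (r : {r : ℕ // r + (k + 1) ≤ q}), (Fin r.1 → Fin q)
  let S : Set (EuclideanSpace ℝ (Fin q)) := ⋃ i : I, Set.range (G.columnMap i.1 i.2.2)
  have hdim : dimH S < Module.finrank ℝ (EuclideanSpace ℝ (Fin q)) := by
    have hle : dimH S ≤ ((q - 1 : ℕ) : ENNReal) := by
      rw [dimH_iUnion]
      refine iSup_le fun i => ?_
      refine (dimH_range_le_of_locally_lipschitzOn
        (G.locallyLipschitz_columnMap i.1 i.2.2)).trans ?_
      rw [Real.dimH_univ_eq_finrank]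
      have := i.2.1.2
      simp only [Module.finrank_prod, finrank_euclideanSpace_fin, Module.finrank_fin_fun]
      exact_mod_cast (by omega : k + i.2.1.1 ≤ q - 1)
    refine hle.trans_lt ?_
    rw [finrank_euclideanSpace_fin]
    have := G.q_pos
    exact_mod_cast (by omega : q - 1 < q)
  refine (dense_compl_of_dimH_lt_finrank hdim).mono fun x hx => ?_
  refine G.isGeneric_of_notMem_range fun θ hθ z hz => hx ?_
  obtain ⟨j, hj⟩ : ∃ j, θ j ≠ 0 := by
    by_contra! hall
    exact hθ (by ext j; exact hall j)
  obtain ⟨η, hη⟩ := exists_chart_eq (j := j) (θ := (θ j)⁻¹ • θ) (by simp [hj])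
  obtain ⟨r, hr, f, hf⟩ := G.exists_columns_span (chart j η)
  have hne : chart j η ≠ 0 := by
    rw [hη]; exact smul_ne_zero (inv_ne_zero hj) hθ
  have hrq : r + (k + 1) ≤ q := by have := h _ hne; omega
  obtain ⟨y, hy⟩ := hf ((θ j) ^ 2 • z)
  refine Set.mem_iUnion.2 ⟨⟨j, ⟨r, hrq⟩, f⟩, (η, y), ?_⟩
  apply WithLp.ofLp_injective 2
  rw [← hz]
  change ∑ i, y i • (G.defect (chart j η)).col (f i) = _
  rw [← hy, hη, defect_smul, Matrix.smul_mulVec, Matrix.mulVec_smul, smul_smul, ← mul_pow,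
    inv_mul_cancel₀ hj, one_pow, one_smul]

/-! ### Multiplicities of the top eigenvalue -/

lemma mem_topEigenspace {θ : EuclideanSpace ℝ (Fin m)} {v : EuclideanSpace ℂ (Fin q)} {s : ℝ}
    (hs : |s| = ‖G.opU θ‖) (hv : G.opU θ v = (s : ℂ) • v) :
    v.ofLp ∈ Module.End.eigenspace (Matrix.toLin' (G.U θ ^ 2)) (G.topEigenvalue θ : ℂ) := by
  rw [Module.End.mem_eigenspace_iff, Matrix.toLin'_apply, ← opU_opU_apply, hv, map_smul, hv,
    smul_smul, topEigenvalue_eq, ← hs, sq_abs, pow_two, Complex.ofReal_mul]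
  rfl

lemma one_le_topMultiplicity (θ : EuclideanSpace ℝ (Fin m)) : 1 ≤ G.topMultiplicity θ := by
  obtain ⟨v, s, hv0, hs, hv⟩ := G.exists_eigenvector_norm θ
  refine Submodule.one_le_finrank_iff.2 fun hbot => hv0 ?_
  have := G.mem_topEigenspace hs hv
  rw [hbot, Submodule.mem_bot] at this
  exact WithLp.ofLp_injective 2 this

/-- As `U(θ)` is `i` times a real matrix, complex conjugation maps eigenvectors of `U(θ)` with
eigenvalue `s` to eigenvectors with eigenvalue `-s`. Hence the eigenvalue `s² ≠ 0` of `U(θ)²` is at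
least double. -/
lemma two_le_topMultiplicity {θ : EuclideanSpace ℝ (Fin m)} (hθ : θ ≠ 0) :
    2 ≤ G.topMultiplicity θ := by
  obtain ⟨v, s, hv0, hs, hv⟩ := G.exists_eigenvector_norm θ
  have hs0 : s ≠ 0 := by
    rintro rfl
    rw [abs_zero, eq_comm, norm_eq_zero] at hs
    exact hθ (G.opU_injective (by rw [hs, map_zero]))
  let w : EuclideanSpace ℂ (Fin q) := WithLp.toLp 2 fun i => (starRingEnd ℂ) (v i)
  have hw : G.opU θ w = ((-s : ℝ) : ℂ) • w := by
    ext i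
    have h1 : ∑ j, G.U θ i j * v j = s * v i := by
      have := congrArg (fun u : EuclideanSpace ℂ (Fin q) => u i) hv
      simpa [opU_apply, Matrix.mulVec, dotProduct] using this
    have h2 := congrArg (starRingEnd ℂ) h1
    have h3 : ∀ j, (starRingEnd ℂ) (G.U θ i j) = -G.U θ i j := fun j => by simp [U]
    simp only [map_sum, map_mul, h3, neg_mul, Finset.sum_neg_distrib, Complex.conj_ofReal] at h2
    have h4 : G.opU θ w i = ∑ j, G.U θ i j * (starRingEnd ℂ) (v j) := by
      simp [opU_apply, Matrix.mulVec, dotProduct, w]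
    rw [h4, neg_eq_iff_eq_neg.1 h2]
    simp [w]
  have hind : LinearIndependent ℂ ![v, w] := by
    rw [LinearIndependent.pair_iff]
    intro a b hab
    have h5 := congrArg (G.opU θ) hab
    rw [map_add, map_smul, map_smul, hv, hw, map_zero, smul_comm a, smul_comm b, Complex.ofReal_neg,
      neg_smul, ← sub_eq_add_neg, ← smul_sub] at h5
    have h6 : a • v - b • w = 0 :=
      (smul_eq_zero.1 h5).resolve_left (by exact_mod_cast hs0)
    have h7 : (2 * a) • v = 0 := by
      have : (2 * a) • v = (a • v + b • w) + (a • v - b • w) := by module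
      rw [this, hab, h6, add_zero]
    have ha : a = 0 := by simpa [hv0] using h7
    have hw0 : w ≠ 0 := by
      intro hw0
      refine hv0 ?_
      ext i
      have := congrArg (fun u : EuclideanSpace ℂ (Fin q) => u i) hw0
      simpa [w] using this
    refine ⟨ha, ?_⟩
    rw [ha, zero_smul, zero_add] at hab
    exact (smul_eq_zero.1 hab).resolve_right hw0
  have hind' : LinearIndependent ℂ ![v.ofLp, w.ofLp] := by
    have := hind.map' (WithLp.linearEquiv 2 ℂ (Fin q → ℂ)).toLinearMap (LinearEquiv.ker _)
    have heq : ![v.ofLp, w.ofLp] = WithLp.linearEquiv 2 ℂ (Fin q → ℂ) ∘ ![v, w] := by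
      ext i : 1
      fin_cases i <;> rfl
    rw [heq]
    exact this
  have hmem : ∀ i, (![v.ofLp, w.ofLp] : Fin 2 → Fin q → ℂ) i
      ∈ Module.End.eigenspace (Matrix.toLin' (G.U θ ^ 2)) (G.topEigenvalue θ : ℂ) := by
    intro i
    fin_cases i
    · exact G.mem_topEigenspace hs hv
    · exact G.mem_topEigenspace (s := -s) (by rwa [abs_neg]) hw
  have := (LinearIndependent.of_comp (Submodule.subtype _)
    (v := fun i => (⟨_, hmem i⟩ : Module.End.eigenspace (Matrix.toLin' (G.U θ ^ 2))
      (G.topEigenvalue θ : ℂ))) hind').fintype_card_le_finrank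
  simpa [topMultiplicity] using this

end StepTwoGroup

end

theorem theoremt3 {q m : ℕ} (G : StepTwoGroup q m) :
    (m ≤ G.minTopMultiplicity → G.IsGM) ∧ (m = 1 ∨ m = 2 → G.IsGM) := by
  have key : (∀ θ : EuclideanSpace ℝ (Fin m), θ ≠ 0 → m ≤ G.topMultiplicity θ) → G.IsGM :=
    fun h => G.isGM_of_dense_isGeneric (G.dense_isGeneric h)
  refine ⟨fun h => key fun θ hθ => h.trans (Nat.sInf_le ⟨θ, hθ, rfl⟩), ?_⟩
  rintro (rfl | rfl)
  · exact key fun θ _ => G.one_le_topMultiplicity θ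
  · exact key fun θ hθ => G.two_le_topMultiplicity hθ
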